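/- Let $I$ be a finite set and let $\Gamma$ be a simplicial graph with vertex set $I$ whose edges $\{i,j\}$ carry labels $m(i,j)\in\mathbb{N}_{\ge 2}$. Let $$A_I=\Bigl\langle \sigma_i\ (i\in I)\ \Bigm|\ \underbrace{\sigma_i\sigma_j\sigma_i\cdots}_{m(i,j)\text{ terms}}=\underbrace{\sigma_j\sigma_i\sigma_j\cdots}_{m(i,j)\text{ terms}}\ \text{for every edge }\{i,j\}\Bigr\rangle$$ be the associated Artin-Tits group, and let $W_I$ be the associated Coxeter group, i.e. the group generated by $s_i$ $(i\in I)$ with the relations $s_i^2=1$ and the same braid relations. Let $CA_I$ (the colored Artin-Tits group) be the kernel of the morphism $\theta_I:A_I\to W_I$, $\sigma_i\mapsto s_i$. For $X\subseteq I$ let $A_X$ be the subgroup of $A_I$ generated by $\{\sigma_i\mid i\in X\}$. A subgroup of $A_I$ is called parabolic if it is conjugate in $A_I$ to some $A_X$ with $X\subseteq I$. Consider the following two statements about $A_I$. Conjecture 1: for all $X,Y\subseteq I$ and all $\omega\in A_I$, the subgroup $(\omega A_Y\omega^{-1})\cap A_X$ is a parabolic subgroup of $A_I$. Conjecture 2: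 for all $X\subseteq I$ and all $\omega\in CA_I$, the subgroup $(\omega A_X\omega^{-1})\cap A_X$ is a parabolic subgroup of $A_I$. Theorem. For every such $I$ and $\Gamma$, Conjecture 2 implies Conjecture 1. Hence (the converse being immediate) Conjectures 1 and 2 are equivalent. -/

import Mathlib

namespace CoxeterMatrix

/-- The braid relator of the pair `i, j`: the quotient of the two alternating words
`⋯ i j i j` and `⋯ j i j i`, both with `M i j` letters, in the free group on `I`.
As usual for a `CoxeterMatrix`, the entry `0` stands for `∞` (no relation, i.e. no edge between
`i` and `j`); in that case, and for `i = j`, the relator is trivial. -/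
def braidRelator {I : Type*} (M : CoxeterMatrix I) (i j : I) : FreeGroup I :=
  ((CoxeterSystem.braidWord M i j).map FreeGroup.of).prod *
    (((CoxeterSystem.braidWord M j i).map FreeGroup.of).prod)⁻¹

/-- The Artin-Tits group `A_I`: generators `σ i` for `i : I`, and the braid relations. -/
abbrev ArtinGroup {I : Type*} (M : CoxeterMatrix I) : Type _ :=
  PresentedGroup (Set.range (Function.uncurry M.braidRelator))

/-- The standard generator `σ_i` of the Artin-Tits group. -/
def artinGen {I : Type*} (M : CoxeterMatrix I) (i : I) : M.ArtinGroup :=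
  PresentedGroup.of i

/-- The braid relations hold in the Coxeter group. -/
theorem lift_braidRelator {I : Type*} (M : CoxeterMatrix I) :
    ∀ r ∈ Set.range (Function.uncurry M.braidRelator), FreeGroup.lift M.simple r = 1 := by
  rintro _ ⟨⟨i, j⟩, rfl⟩
  have h := M.toCoxeterSystem.wordProd_braidWord_eq i j
  simp only [CoxeterSystem.wordProd, toCoxeterSystem_simple] at h
  have hl : ∀ l : List I,
      FreeGroup.lift M.simple (l.map FreeGroup.of).prod = (l.map M.simple).prod := by
    intro l
    rw [map_list_prod, List.map_map]
    congr 2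
  simp only [Function.uncurry, braidRelator, map_mul, map_inv, hl]
  rw [h, mul_inv_cancel]

/-- The canonical morphism `θ : A_I → W_I` onto the Coxeter group, sending `σ_i` to `s_i`. -/
def artinToCoxeter {I : Type*} (M : CoxeterMatrix I) : M.ArtinGroup →* M.Group :=
  PresentedGroup.toGroup M.lift_braidRelator

/-- The canonical morphism sends `σ_i` to `s_i`. -/
theorem artinToCoxeter_artinGen {I : Type*} (M : CoxeterMatrix I) (i : I) :
    M.artinToCoxeter (M.artinGen i) = M.simple i :=
  PresentedGroup.toGroup.of M.lift_braidRelator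

/-- The colored (or pure) Artin-Tits group `CA_I`, the kernel of `θ : A_I → W_I`. -/
def coloredArtinGroup {I : Type*} (M : CoxeterMatrix I) : Subgroup M.ArtinGroup :=
  M.artinToCoxeter.ker

/-- The standard parabolic subgroup `A_X` of `A_I`, generated by the `σ_i` with `i ∈ X`. -/
def standardParabolic {I : Type*} (M : CoxeterMatrix I) (X : Set I) : Subgroup M.ArtinGroup :=
  Subgroup.closure (M.artinGen '' X)

/-- The conjugate `g H g⁻¹` of a subgroup `H` of the Artin-Tits group. -/
def conjSubgroup {I : Type*} (M : CoxeterMatrix I) (g : M.ArtinGroup)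
    (H : Subgroup M.ArtinGroup) : Subgroup M.ArtinGroup :=
  H.map (MulAut.conj g).toMonoidHom

/-- A parabolic subgroup of `A_I` is a conjugate of a standard parabolic subgroup. -/
def IsParabolic {I : Type*} (M : CoxeterMatrix I) (P : Subgroup M.ArtinGroup) : Prop :=
  ∃ (X : Set I) (g : M.ArtinGroup), P = M.conjSubgroup g (M.standardParabolic X)

/-- The intersection conjecture for `A_I`: for all `X, Y ⊆ I` and all `ω` in `A_I`, the subgroup
`(ω A_Y ω⁻¹) ∩ A_X` is parabolic. -/
def IntersectionConjecture {I : Type*} (M : CoxeterMatrix I) : Prop :=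
  ∀ (X Y : Set I) (ω : M.ArtinGroup),
    M.IsParabolic (M.conjSubgroup ω (M.standardParabolic Y) ⊓ M.standardParabolic X)

/-- The colored intersection conjecture for `A_I`: for all `X ⊆ I` and all `ω` in the colored
Artin-Tits group `CA_I`, the subgroup `(ω A_X ω⁻¹) ∩ A_X` is parabolic. -/
def ColoredIntersectionConjecture {I : Type*} (M : CoxeterMatrix I) : Prop :=
  ∀ (X : Set I), ∀ ω ∈ M.coloredArtinGroup,
    M.IsParabolic (M.conjSubgroup ω (M.standardParabolic X) ⊓ M.standardParabolic X)

end CoxeterMatrix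

/-! Multiplying `ω` by elements of `A_X` and `A_Y` makes `d = θ ω` the shortest element of `W_Y d
W_X`. Put `Z = X ∩ d⁻¹ Y d` and `Z' = Y ∩ d X d⁻¹`. Then `ω⁻¹ A_Y ω ∩ A_X ⊆ h⁻¹ A_Z h` for some
colored `h ∈ A_X`, and symmetrically `ω A_X ω⁻¹ ∩ A_Y ⊆ k⁻¹ A_{Z'} k` for some colored `k ∈ A_Y`. A
lift `δ` of `d` conjugates `A_Z` to `A_{Z'}`. Hence `ω⁻¹ A_Y ω ∩ A_X = h⁻¹ (c A_Z c⁻¹ ∩ A_Z) h` with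
`c = h ω⁻¹ k⁻¹ δ`, and `c` is colored because `θ c = d⁻¹ d = 1`; Conjecture 2 applies to it.

The element `h` comes from an action of `A` on `W/W_X × A`. With `d_p` the shortest element of the
coset `p`, the generator `σ_i` sends `(p, g)` to `(s_i p, f g)`, where `f = σ_x` if `s_i d_p = d_p
s_x` with `x ∈ X`, and `f = 1` otherwise. That this respects the braid relations is
`wordFactor_braidWord`. Over the base coset `A_X` acts by left translation; started at `d W_X`, an
element of `A_Y` contributes only letters of `Z`. Write `ω · (W_X, 1) = (d W_X, h)`. If `a ∈ A_X`
and `b = ω a ω⁻¹ ∈ A_Y`, then `b · (d W_X, h) = (d W_X, h a)`, so `h a h⁻¹ ∈ A_Z`.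

The rest is Coxeter theory: the geometric representation gives the orders of the `s_i s_j`, parity
of inversions gives exchange, exchange gives minimal coset representatives and Matsumoto's theorem,
and the latter gives `δ`. -/

namespace CoxeterMatrix

/-! ### The geometric representation. -/

open Real Module

/-- The linear form `x ↦ 2 B(e_i, x)` of the geometric representation. -/
noncomputable def geomForm {I : Type*} (M : CoxeterMatrix I) (i : I) : Dual ℝ (I →₀ ℝ) :=
  Finsupp.linearCombination ℝ fun j => -2 * cos (π / M i j)

theorem geomForm_single {I : Type*} (M : CoxeterMatrix I) (i j : I) :
    M.geomForm i (Finsupp.single j 1) = -2 * cos (π / M i j) := by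
  simp [geomForm]

theorem geomForm_single_self {I : Type*} (M : CoxeterMatrix I) (i : I) :
    M.geomForm i (Finsupp.single i 1) = 2 := by
  simp [geomForm_single]

/-- The simple reflections of the geometric representation. -/
noncomputable def geomReflection {I : Type*} (M : CoxeterMatrix I) (i : I) :
    (I →₀ ℝ) ≃ₗ[ℝ] (I →₀ ℝ) :=
  Module.reflection (M.geomForm_single_self i)

theorem geomForm_mul_geomForm {I : Type*} (M : CoxeterMatrix I) (i j : I) :
    2 * cos (2 * π / M i j) =
      M.geomForm i (Finsupp.single j 1) * M.geomForm j (Finsupp.single i 1) - 2 := by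
  rw [geomForm_single, geomForm_single, M.symmetric j i, mul_div_assoc, cos_two_mul]
  ring

theorem sin_two_pi_div_pos {m : ℕ} (hm : 3 ≤ m) : 0 < sin (2 * π / m) := by
  have h3 : (3 : ℝ) ≤ m := by exact_mod_cast hm
  apply sin_pos_of_pos_of_lt_pi
  · positivity
  · rw [div_lt_iff₀ (by linarith)]
    nlinarith [pi_pos]

/-- Powers of a product of two reflections are governed by Chebyshev polynomials, with `S_k(2 cos θ)
sin θ = sin ((k+1)θ)` and `θ = 2π/m`. For `m = 2k` the coefficient `S_{k-1}` vanishes since `kθ =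
π`; for `m = 2k+1` the sum `S_k + S_{k-1}` vanishes since `(k+1)θ = 2π - kθ`. Cancelling `sin θ`
needs `m ≥ 3`. -/
theorem geomReflection_isLiftable {I : Type*} (M : CoxeterMatrix I) :
    M.IsLiftable M.geomReflection := by
  intro i j
  ext1 z
  change ((Module.reflection (M.geomForm_single_self i) *
    Module.reflection (M.geomForm_single_self j)) ^ M i j) z = z
  rw [reflection_mul_reflection_pow_apply _ _ _ _ _ (M.geomForm_mul_geomForm i j)]
  rcases eq_or_ne i j with rfl | hij
  · simp only [M.diagonal, geomForm_single_self]
    rw [show 2 * M.geomForm i z - M.geomForm i z = M.geomForm i z by ring]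
    simp
  have h1 : M i j ≠ 1 := M.off_diagonal i j hij
  obtain h | h | h : M i j = 0 ∨ M i j = 2 ∨ 3 ≤ M i j := by omega
  · simp [h]
  · simp [h, geomForm_single, M.symmetric j i]
    module
  · have hs := sin_two_pi_div_pos h
    set m := M i j with hm
    have hm0 : (m : ℝ) ≠ 0 := by positivity
    set θ := 2 * π / (m : ℝ) with hθ
    have hmθ : m * θ = 2 * π := by rw [hθ]; field_simp
    have key := fun n : ℤ => Polynomial.Chebyshev.S_two_mul_real_cos θ n
    obtain ⟨k, hk | hk⟩ := Nat.even_or_odd' m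
    · have e1 : ((m : ℤ) - 2) / 2 = k - 1 := by omega
      have e2 : ((m : ℤ) - 1) / 2 = k - 1 := by omega
      have : (Polynomial.Chebyshev.S ℝ (k - 1)).eval (2 * cos θ) = 0 := by
        have := key (k - 1)
        have h2 : ((((k : ℤ) - 1 : ℤ) : ℝ) + 1) * θ = π := by
          push_cast
          rw [hk] at hmθ
          push_cast at hmθ
          linarith
        rw [h2, sin_pi] at this
        exact (mul_eq_zero.mp this).resolve_right hs.ne'
      rw [e1, e2, this]
      simp
    · have e1 : ((m : ℤ) - 2) / 2 = k - 1 := by omega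
      have e2 : ((m : ℤ) - 1) / 2 = k := by omega
      have e3 : ((m : ℤ) - 3) / 2 = k - 1 := by omega
      have e4 : (m : ℤ) / 2 = k := by omega
      have : (Polynomial.Chebyshev.S ℝ k).eval (2 * cos θ) +
          (Polynomial.Chebyshev.S ℝ (k - 1)).eval (2 * cos θ) = 0 := by
        have ha := key k
        have hb := key (k - 1)
        have h2 : ((k : ℤ) + 1 : ℝ) * θ = 2 * π - ((((k : ℤ) - 1 : ℤ) : ℝ) + 1) * θ := by
          push_cast
          rw [hk] at hmθ
          push_cast at hmθ
          linarith
        rw [h2, sin_two_pi_sub] at ha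
        have : ((Polynomial.Chebyshev.S ℝ k).eval (2 * cos θ) +
          (Polynomial.Chebyshev.S ℝ (k - 1)).eval (2 * cos θ)) * sin θ = 0 := by
          rw [add_mul, ha, hb]; ring
        exact (mul_eq_zero.mp this).resolve_right hs.ne'
      rw [e1, e2, e3, e4, this]
      simp

/-- Apply the power to `e_i`. For `m ≥ 3` the `e_j` coordinate forces `S_{n-1} = 0`, then the `e_i`
coordinate gives `S_n = 1`. So `sin (nθ) = 0` and `sin ((n+1)θ) = sin θ`, whence `cos (nθ) = 1`. -/
theorem dvd_of_geomReflection_pow_eq_one {I : Type*} (M : CoxeterMatrix I) (i j : I) (n : ℕ)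
    (h : (M.geomReflection i * M.geomReflection j) ^ n = 1) : M i j ∣ n := by
  rcases eq_or_ne i j with rfl | hij
  · simp
  have h1 : M i j ≠ 1 := M.off_diagonal i j hij
  have hn := reflection_mul_reflection_pow_apply_self (M.geomForm_single_self i)
    (M.geomForm_single_self j) n _ (M.geomForm_mul_geomForm i j)
  change ((M.geomReflection i * M.geomReflection j) ^ n) _ = _ at hn
  rw [h] at hn
  have hni := DFunLike.congr_fun hn i
  have hnj := DFunLike.congr_fun hn j
  simp [hij, hij.symm, geomForm_single, M.symmetric j i] at hni hnj
  obtain h | h | h : M i j = 0 ∨ M i j = 2 ∨ 3 ≤ M i j := by omega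
  -- The label `∞` is encoded as `0`, and `π / 0 = 0` makes the form take the value `-2`; then
  -- `S_{n-1}(2) = n` must vanish.
  · simp [h, Polynomial.Chebyshev.S_eval_two] at hnj ⊢
    exact hnj
  -- Since `cos (π / 2) = 0`, only the `e_i` coordinate, equal to `(-1)^n`, carries information.
  · simp [h, Polynomial.Chebyshev.S_eval_neg_two, Int.negOnePow_sub] at hni ⊢
    by_contra hodd
    have hodd : Odd n := by rwa [← even_iff_two_dvd, Nat.not_even_iff_odd] at hodd
    rw [hodd.neg_one_pow] at hni
    linarith
  · have hs := sin_two_pi_div_pos h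
    set m := M i j with hm
    have hm0 : (m : ℝ) ≠ 0 := by positivity
    have hc : cos (π / m) ≠ 0 := by
      have h3 : (3 : ℝ) ≤ m := by exact_mod_cast h
      apply ne_of_gt
      apply cos_pos_of_mem_Ioo
      constructor
      · have : 0 < π / m := by positivity
        linarith [pi_pos]
      · gcongr; linarith
    set θ := 2 * π / (m : ℝ) with hθ
    have hS : (Polynomial.Chebyshev.S ℝ (n - 1)).eval (2 * cos θ) = 0 := by
      simpa [hc] using hnj
    rw [hS, add_zero] at hni
    have ha := Polynomial.Chebyshev.S_two_mul_real_cos θ n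
    have hb := Polynomial.Chebyshev.S_two_mul_real_cos θ (n - 1)
    rw [← hni, one_mul] at ha
    rw [hS, zero_mul] at hb
    push_cast at ha hb
    rw [sub_add_cancel] at hb
    rw [add_mul, one_mul, sin_add, ← hb, zero_mul, zero_add] at ha
    have hcos : cos (n * θ) = 1 := by
      have : (cos (n * θ) - 1) * sin θ = 0 := by rw [sub_mul, ← ha]; ring
      have := (mul_eq_zero.mp this).resolve_right hs.ne'
      linarith
    obtain ⟨l, hl⟩ := (cos_eq_one_iff _).mp hcos
    have : (l : ℝ) * m = n := by
      have h2 : (2 * π) * (l * m) = (2 * π) * n := by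
        have : (m : ℝ) * θ = 2 * π := by rw [hθ]; field_simp
        calc 2 * π * (l * m) = (l * (2 * π)) * m := by ring
          _ = n * (m * θ) := by rw [hl]; ring
          _ = _ := by rw [this]; ring
      exact mul_left_cancel₀ (by positivity) h2
    have : l * (m : ℤ) = n := by exact_mod_cast this
    exact_mod_cast Dvd.intro_left _ this

end CoxeterMatrix

/-! ### Orders of products of generators, inversion sequences and the exchange condition. -/

namespace CoxeterSystem

variable {B W : Type*} [Group W] {M : CoxeterMatrix B} (cs : CoxeterSystem M W)

theorem orderOf_simple_mul_simple (i j : B) : orderOf (cs.simple i * cs.simple j) = M i j := by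
  apply Nat.dvd_antisymm
  · exact orderOf_dvd_of_pow_eq_one (cs.simple_mul_simple_pow i j)
  · apply M.dvd_of_geomReflection_pow_eq_one
    rw [← cs.lift_apply_simple M.geomReflection_isLiftable i,
      ← cs.lift_apply_simple M.geomReflection_isLiftable j, ← map_mul, ← map_pow,
      pow_orderOf_eq_one, map_one]

theorem simple_injective : Function.Injective cs.simple := by
  intro i j h
  by_contra hij
  apply M.off_diagonal i j hij
  rw [← cs.orderOf_simple_mul_simple, h, cs.simple_mul_simple_self, orderOf_one]

open List in
theorem rightInvSeq_alternatingWord (i j : B) (n : ℕ) :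
    cs.rightInvSeq (alternatingWord i j n) =
      ((range n).map fun k => cs.wordProd (alternatingWord i j (2 * k + 1))).reverse := by
  induction n generalizing i j with
  | zero => simp [alternatingWord]
  | succ n ih =>
    rw [alternatingWord_succ, rightInvSeq_concat, ih, range_succ_eq_map]
    simp only [map_reverse, map_map, map_cons, reverse_cons, concat_eq_append]
    congr 2
    · apply map_congr_left
      intro k _
      simp only [Function.comp, MulAut.conj_apply, inv_simple]
      have e1 : alternatingWord i j (2 * k.succ + 1) =
          (j :: alternatingWord j i (2 * k + 1)).concat j := by
        rw [alternatingWord_succ, show 2 * k.succ = 2 * k + 1 + 1 by simp; ring,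
          alternatingWord_succ' j i, if_neg (by simp [parity_simps])]
      rw [e1, wordProd_concat, wordProd_cons]
    · simp [alternatingWord]

open List in
-- In the dihedral group of order `2m`, the alternating word of length `2k+1` equals the opposite
-- one of length `2m - (2k+1)`, so the two sequences are reverses of each other.
theorem rightInvSeq_braidWord_perm (i j : B) :
    cs.rightInvSeq (braidWord M i j) ~ cs.rightInvSeq (braidWord M j i) := by
  rw [rightInvSeq_alternatingWord, rightInvSeq_alternatingWord, M.symmetric j i]
  refine (reverse_perm _).trans (Perm.of_eq ?_)
  apply ext_getElem
  · simp
  · intro k h1 h2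
    simp only [length_map, length_range] at h1
    simp only [getElem_map, getElem_range, getElem_reverse, length_map, length_range]
    rw [prod_alternatingWord_eq_prod_alternatingWord_sub _ _ _ _ (by omega)]
    congr 2
    omega

open Classical in
/-- The action of a simple reflection on pairs of a group element and a sign. -/
noncomputable def signedReflection (i : B) : Equiv.Perm (W × ZMod 2) :=
  Function.Involutive.toPerm
    (fun p => (cs.simple i * p.1 * cs.simple i, p.2 + if cs.simple i = p.1 then 1 else 0)) <| by
    rintro ⟨t, e⟩
    have h : cs.simple i = cs.simple i * t * cs.simple i ↔ cs.simple i = t := by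
      constructor
      · intro h
        have := congrArg (fun z => cs.simple i * z * cs.simple i) h
        simpa [mul_assoc] using this
      · rintro rfl; simp
    simp only [h]
    ext1
    · simp [mul_assoc]
    · simp only [add_assoc]
      split_ifs
      · rw [CharTwo.add_self_eq_zero, add_zero]
      · simp

open Classical in
theorem signedReflection_prod (ω : List B) (t : W) (e : ZMod 2) :
    (ω.map cs.signedReflection).prod (t, e) =
      (cs.wordProd ω * t * (cs.wordProd ω)⁻¹, e + (cs.rightInvSeq ω).count t) := by
  induction ω with
  | nil => simp
  | cons i ω ih =>
    rw [List.map_cons, List.prod_cons, Equiv.Perm.mul_apply, ih, rightInvSeq, List.count_cons]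
    have h : cs.simple i = cs.wordProd ω * t * (cs.wordProd ω)⁻¹ ↔
        (cs.wordProd ω)⁻¹ * cs.simple i * cs.wordProd ω = t := by
      constructor
      · intro h; rw [h]; group
      · rintro rfl; group
    change (_, _) = _
    ext1
    · simp [wordProd_cons, mul_assoc]
    · simp [h, add_assoc]

/-- The inversion sequence of the relator, of length `2m`, runs twice through the same `m`
reflections, so every sign changes an even number of times. -/
theorem signedReflection_isLiftable : M.IsLiftable cs.signedReflection := by
  classical
  intro i j
  have hp : ∀ n, (cs.signedReflection i * cs.signedReflection j) ^ n =
      ((alternatingWord i j (2 * n)).map cs.signedReflection).prod := by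
    intro n
    induction n with
    | zero => simp [alternatingWord]
    | succ n ih =>
      rw [pow_succ, ih, show 2 * (n + 1) = 2 * n + 1 + 1 by ring, alternatingWord_succ,
        alternatingWord_succ]
      simp
  ext1 ⟨t, e⟩
  have h1 : cs.wordProd (alternatingWord i j (2 * M i j)) = 1 := by
    simp [prod_alternatingWord_eq_mul_pow]
  have h2 : ((List.range (2 * M i j)).map
      fun k => cs.wordProd (alternatingWord i j (2 * k + 1))) =
      ((List.range (M i j)).map fun k => cs.wordProd (alternatingWord i j (2 * k + 1))) ++
      ((List.range (M i j)).map fun k => cs.wordProd (alternatingWord i j (2 * k + 1))) := by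
    rw [two_mul, List.range_add, List.map_append, List.map_map]
    congr 1
    apply List.map_congr_left
    intro k _
    have e1 : ¬ Even (2 * (M i j + k) + 1) := by simp [parity_simps]
    have e2 : ¬ Even (2 * k + 1) := by simp [parity_simps]
    simp only [Function.comp, prod_alternatingWord_eq_mul_pow, e1, e2, if_false]
    rw [show (2 * (M i j + k) + 1) / 2 = M i j + k by omega, show (2 * k + 1) / 2 = k by omega,
      pow_add, simple_mul_simple_pow, one_mul]
  rw [hp, signedReflection_prod, h1, rightInvSeq_alternatingWord, List.count_reverse, h2,
    List.count_append, Nat.cast_add, CharTwo.add_self_eq_zero]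
  simp

open Classical in
theorem count_rightInvSeq_cast_eq {ω ω' : List B} (h : cs.wordProd ω = cs.wordProd ω') (t : W) :
    ((cs.rightInvSeq ω).count t : ZMod 2) = (cs.rightInvSeq ω').count t := by
  have key : ∀ ω : List B, (ω.map cs.signedReflection).prod =
      cs.lift ⟨_, cs.signedReflection_isLiftable⟩ (cs.wordProd ω) := by
    intro ω
    rw [wordProd, map_list_prod, List.map_map]
    congr 1
    apply List.map_congr_left
    intro i _
    simp [Function.comp]
  have hp : (ω.map cs.signedReflection).prod = (ω'.map cs.signedReflection).prod := by
    rw [key, key, h]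
  have := congrArg (fun f => (f (t, 0)).2) hp
  simpa only [signedReflection_prod, zero_add] using this

/-- A reduced word ending in `i` has `s_i` exactly once in its inversion sequence. The parity of
this count depends only on the element, so it is odd for every word. -/
theorem simple_mem_rightInvSeq {ω : List B} {i : B} (h : cs.IsRightDescent (cs.wordProd ω) i) :
    cs.simple i ∈ cs.rightInvSeq ω := by
  classical
  obtain ⟨ω', hω', e⟩ := cs.exists_isReduced (cs.wordProd ω * cs.simple i)
  have e' : cs.wordProd (ω'.concat i) = cs.wordProd ω := by
    rw [wordProd_concat, ← e, simple_mul_simple_cancel_right]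
  have hred : cs.IsReduced (ω'.concat i) := by
    rw [IsReduced, e', List.length_concat, ← hω'.eq, ← e]
    exact ((cs.isRightDescent_iff).mp h).symm
  have hmem : cs.simple i ∈ cs.rightInvSeq (ω'.concat i) := by
    rw [rightInvSeq_concat]
    simp
  have h1 := List.count_eq_one_of_mem hred.nodup_rightInvSeq hmem
  have h2 := cs.count_rightInvSeq_cast_eq e' (cs.simple i)
  rw [h1] at h2
  by_contra hn
  rw [List.count_eq_zero_of_not_mem hn] at h2
  simp at h2

theorem exists_eraseIdx_of_isRightDescent {ω : List B} {i : B}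
    (h : cs.IsRightDescent (cs.wordProd ω) i) :
    ∃ k < ω.length, cs.wordProd ω * cs.simple i = cs.wordProd (ω.eraseIdx k) := by
  obtain ⟨k, hk, e⟩ := List.getElem_of_mem (cs.simple_mem_rightInvSeq h)
  refine ⟨k, by simpa using hk, ?_⟩
  rw [← wordProd_mul_getD_rightInvSeq, List.getD_eq_getElem _ _ hk, e]

/-! ### Parabolic subgroups of the Coxeter group and minimal coset representatives. -/

/-- The standard parabolic subgroup of a Coxeter group. -/
def parabolic (X : Set B) : Subgroup W := Subgroup.closure (cs.simple '' X)

theorem simple_mem_parabolic {X : Set B} {x : B} (hx : x ∈ X) : cs.simple x ∈ cs.parabolic X :=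
  Subgroup.subset_closure ⟨x, hx, rfl⟩

theorem wordProd_mem_parabolic {X : Set B} {ω : List B} (h : ∀ i ∈ ω, i ∈ X) :
    cs.wordProd ω ∈ cs.parabolic X :=
  Subgroup.list_prod_mem _ fun y hy => by
    obtain ⟨k, hk, rfl⟩ := List.mem_map.mp hy
    exact cs.simple_mem_parabolic (h k hk)

theorem exists_isReduced_of_mem_parabolic {X : Set B} {u : W} (hu : u ∈ cs.parabolic X) :
    ∃ ω, cs.IsReduced ω ∧ (∀ i ∈ ω, i ∈ X) ∧ u = cs.wordProd ω := by
  have step : ∀ u, ∀ x ∈ X, (∃ ω, cs.IsReduced ω ∧ (∀ i ∈ ω, i ∈ X) ∧ u = cs.wordProd ω) →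
      ∃ ω, cs.IsReduced ω ∧ (∀ i ∈ ω, i ∈ X) ∧ u * cs.simple x = cs.wordProd ω := by
    rintro _ x hx ⟨ω, hω, hX, rfl⟩
    by_cases h : cs.IsRightDescent (cs.wordProd ω) x
    · obtain ⟨k, hk, e⟩ := cs.exists_eraseIdx_of_isRightDescent h
      refine ⟨_, ?_, fun i hi => hX i (List.mem_of_mem_eraseIdx hi), e⟩
      rw [IsReduced, ← e, List.length_eraseIdx_of_lt hk, ← hω.eq]
      have := cs.isRightDescent_iff.mp h
      omega
    · refine ⟨ω.concat x, ?_, ?_, (cs.wordProd_concat _ _).symm⟩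
      · rw [IsReduced, wordProd_concat, List.length_concat, cs.not_isRightDescent_iff.mp h, hω.eq]
      · intro i hi
        rw [List.concat_eq_append, List.mem_append, List.mem_singleton] at hi
        rcases hi with hi | rfl
        · exact hX i hi
        · exact hx
  induction hu using Subgroup.closure_induction_right with
  | one => exact ⟨[], by simp [IsReduced], by simp, by simp⟩
  | mul_right u _ y hy ih => obtain ⟨x, hx, rfl⟩ := hy; exact step u x hx ih
  | mul_inv_cancel u _ y hy ih =>
    obtain ⟨x, hx, rfl⟩ := hy
    rw [inv_simple]
    exact step u x hx ih

theorem eq_simple_of_mem_parabolic {X : Set B} {u : W} (hu : u ∈ cs.parabolic X)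
    (h : cs.length u = 1) : ∃ x ∈ X, u = cs.simple x := by
  obtain ⟨ω, hω, hX, rfl⟩ := cs.exists_isReduced_of_mem_parabolic hu
  obtain ⟨x, rfl⟩ := List.length_eq_one_iff.mp (hω.eq.symm.trans h)
  exact ⟨x, hX x (by simp), by simp⟩

/-- `d` is of minimal length in its coset `d W_X`. -/
def IsMinimal (X : Set B) (d : W) : Prop :=
  ∀ u ∈ cs.parabolic X, cs.length d ≤ cs.length (d * u)

theorem isMinimal_one (X : Set B) : cs.IsMinimal X 1 := by
  intro u _
  simp

-- Were the length to drop when a letter is appended, exchange would delete a letter either from the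
-- word of `d`, against minimality, or from the word of `u`, against reducedness.
variable {cs} in
theorem IsMinimal.length_mul {X : Set B} {d u : W} (hd : cs.IsMinimal X d)
    (hu : u ∈ cs.parabolic X) : cs.length (d * u) = cs.length d + cs.length u := by
  obtain ⟨ω, hω, hX, rfl⟩ := cs.exists_isReduced_of_mem_parabolic hu
  clear hu
  rw [hω.eq]
  obtain ⟨δ, hδ, rfl⟩ := cs.exists_isReduced d
  induction ω using List.reverseRecOn with
  | nil => simp
  | append_singleton ω i ih =>
    have hω' : cs.IsReduced ω := by simpa using hω.take ω.length
    have ih := ih hω' fun k hk => hX k (by simp [hk])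
    have hi : i ∈ X := hX i (by simp)
    have hmem : cs.wordProd ω ∈ cs.parabolic X :=
      cs.wordProd_mem_parabolic fun k hk => hX k (by simp [hk])
    have hdesc : ¬ cs.IsRightDescent (cs.wordProd (δ ++ ω)) i := by
      intro h
      obtain ⟨k, hk, e⟩ := cs.exists_eraseIdx_of_isRightDescent h
      rcases lt_or_ge k δ.length with hk' | hk'
      · rw [List.eraseIdx_append_of_lt_length hk', wordProd_append, wordProd_append] at e
        have h1 := hd (cs.wordProd ω * cs.simple i * (cs.wordProd ω)⁻¹)
          (mul_mem (mul_mem hmem (cs.simple_mem_parabolic hi)) (inv_mem hmem))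
        rw [← mul_assoc, ← mul_assoc, e, mul_inv_cancel_right, hδ.eq] at h1
        have h2 := cs.length_wordProd_le (δ.eraseIdx k)
        rw [List.length_eraseIdx_of_lt hk'] at h2
        omega
      · rw [List.eraseIdx_append_of_length_le hk', wordProd_append, wordProd_append, mul_assoc,
          mul_left_cancel_iff] at e
        have h1 := hω.eq
        rw [wordProd_append, wordProd_singleton, e] at h1
        have h2 := cs.length_wordProd_le (ω.eraseIdx (k - δ.length))
        rw [List.length_eraseIdx_of_lt (by rw [List.length_append] at hk; omega)] at h2
        rw [List.length_append, List.length_singleton] at h1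
        omega
    rw [not_isRightDescent_iff, wordProd_append] at hdesc
    rw [wordProd_append, wordProd_singleton, ← mul_assoc, hdesc, ih]
    simp [add_assoc]

variable {cs} in
theorem IsMinimal.length_mul_left {X : Set B} {d u : W} (hd : cs.IsMinimal X d⁻¹)
    (hu : u ∈ cs.parabolic X) : cs.length (u * d) = cs.length u + cs.length d := by
  rw [← cs.length_inv, mul_inv_rev, hd.length_mul (inv_mem hu), cs.length_inv, cs.length_inv,
    add_comm]

theorem exists_isMinimal (X : Set B) (w : W) : ∃ u ∈ cs.parabolic X, cs.IsMinimal X (w * u) := by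
  obtain ⟨u, hu, h⟩ := WellFounded.has_min (measure fun u => cs.length (w * u)).wf
    (cs.parabolic X : Set W) ⟨1, one_mem _⟩
  refine ⟨u, hu, fun u' hu' => ?_⟩
  rw [mul_assoc]
  exact not_lt.mp (h (u * u') (mul_mem hu hu'))

variable {cs} in
theorem IsMinimal.eq_one {X : Set B} {d u : W} (hd : cs.IsMinimal X d)
    (hu : u ∈ cs.parabolic X) (hdu : cs.IsMinimal X (d * u)) : u = 1 := by
  have h1 := hd.length_mul hu
  have h2 := hdu.length_mul (inv_mem hu)
  rw [mul_inv_cancel_right] at h2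
  rw [← cs.length_eq_zero_iff]
  omega

-- Deodhar's lemma. If `s_i d u` is minimal, comparing lengths gives `ℓ(u) ≤ 1`. If `u = s_x`,
-- exchange in `s_i d` must delete the letter `i`: deleting a letter of `d` would make `d s_x`
-- shorter than `d`.
variable {cs} in
theorem IsMinimal.simple_mul {X : Set B} {d : W} (hd : cs.IsMinimal X d) (i : B) :
    cs.IsMinimal X (cs.simple i * d) ∨ ∃ x ∈ X, cs.simple i * d = d * cs.simple x := by
  obtain ⟨u, hu, hmin⟩ := cs.exists_isMinimal X (cs.simple i * d)
  have h1 := hmin.length_mul (inv_mem hu)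
  have h2 := hd.length_mul hu
  rw [mul_inv_cancel_right, cs.length_inv] at h1
  have h3 := cs.length_simple_mul (d * u) i
  have h4 := cs.length_simple_mul d i
  rw [← mul_assoc] at h3
  by_cases h0 : cs.length u = 0
  · rw [cs.length_eq_zero_iff.mp h0, mul_one] at hmin
    exact Or.inl hmin
  right
  obtain ⟨x, hx, rfl⟩ := cs.eq_simple_of_mem_parabolic hu (by omega)
  refine ⟨x, hx, ?_⟩
  obtain ⟨δ, hδ, rfl⟩ := cs.exists_isReduced d
  rw [cs.length_simple] at h1 h2
  have hdesc : cs.IsRightDescent (cs.wordProd (i :: δ)) x := by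
    rw [IsRightDescent, wordProd_cons]
    omega
  obtain ⟨k, hk, e⟩ := cs.exists_eraseIdx_of_isRightDescent hdesc
  rw [wordProd_cons] at e
  rcases k with _ | k
  · rw [← cs.simple_mul_simple_cancel_right (w := cs.simple i * cs.wordProd δ) x, e]
    simp
  · rw [List.eraseIdx_cons_succ, wordProd_cons, mul_assoc, mul_left_cancel_iff] at e
    have h5 := cs.length_wordProd_le (δ.eraseIdx k)
    rw [List.length_eraseIdx_of_lt (by simpa using hk), ← e, h2, hδ.eq] at h5
    omega

-- Computing `ℓ(d s_x)` from both sides shows that the conjugate has length one.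
variable {cs} in
theorem IsMinimal.exists_simple_eq_conj {X Y : Set B} {d : W} (hd : cs.IsMinimal X d)
    (hd' : cs.IsMinimal Y d⁻¹) {x : B} (hx : x ∈ X)
    (h : d * cs.simple x * d⁻¹ ∈ cs.parabolic Y) : ∃ y ∈ Y, d * cs.simple x * d⁻¹ = cs.simple y := by
  apply cs.eq_simple_of_mem_parabolic h
  have h1 := hd'.length_mul_left h
  rw [inv_mul_cancel_right, hd.length_mul (cs.simple_mem_parabolic hx), cs.length_simple] at h1
  omega

theorem exists_isMinimal_both (X Y : Set B) (w : W) : ∃ u ∈ cs.parabolic X, ∃ v ∈ cs.parabolic Y,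
    cs.IsMinimal X (v * w * u) ∧ cs.IsMinimal Y (v * w * u)⁻¹ := by
  obtain ⟨⟨u, v⟩, ⟨hu, hv⟩, h⟩ := WellFounded.has_min
    (measure fun p : W × W => cs.length (p.2 * w * p.1)).wf
    {p | p.1 ∈ cs.parabolic X ∧ p.2 ∈ cs.parabolic Y} ⟨1, one_mem _, one_mem _⟩
  refine ⟨u, hu, v, hv, fun u' hu' => ?_, fun v' hv' => ?_⟩
  · rw [mul_assoc (v * w)]
    exact not_lt.mp (h (u * u', v) ⟨mul_mem hu hu', hv⟩)
  · have : cs.length (v * w * u) ≤ cs.length (v'⁻¹ * v * w * u) :=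
      not_lt.mp (h (u, v'⁻¹ * v) ⟨hu, mul_mem (inv_mem hv') hv⟩)
    rw [← cs.length_inv, ← cs.length_inv (_ * v')]
    simpa [mul_assoc] using this

variable {cs} in
/-- If `d` is minimal in `W_Y d` and `r d` is minimal in `r d W_X` with `r ∈ W_Y`, then so is
`d`. -/
theorem IsMinimal.of_mul {X Y : Set B} {d r : W} (hd : cs.IsMinimal Y d⁻¹)
    (hr : r ∈ cs.parabolic Y) (h : cs.IsMinimal X (r * d)) : cs.IsMinimal X d := by
  intro u hu
  have h1 := h u hu
  rw [hd.length_mul_left hr, mul_assoc] at h1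
  have := cs.length_mul_le r (d * u)
  omega

/-! ### Matsumoto's theorem. -/

variable {cs} in
theorem IsReduced.of_concat {ω : List B} {i : B} (h : cs.IsReduced (ω.concat i)) :
    cs.IsReduced ω := by
  simpa using h.take ω.length

variable {cs} in
theorem IsReduced.eq_alternatingWord {i j : B} {ω : List B} (hω : cs.IsReduced ω)
    (h : ∀ k ∈ ω, k = i ∨ k = j) :
    ω = alternatingWord i j ω.length ∨ ω = alternatingWord j i ω.length := by
  induction ω using List.reverseRecOn with
  | nil => simp [alternatingWord]
  | append_singleton ω k ih =>
    rw [← List.concat_eq_append] at *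
    have aux : ∀ {a b}, ω = alternatingWord a b ω.length → k = a ∨ k = b →
        ω.concat k = alternatingWord b a (ω.length + 1) ∨
          ω.concat k = alternatingWord a b (ω.length + 1) := by
      rintro a b e (rfl | rfl)
      · left
        rw [alternatingWord_succ, ← e]
      · rcases hn : ω.length with _ | m
        · right
          rw [List.eq_nil_of_length_eq_zero hn]
          simp [alternatingWord]
        · exfalso
          rw [hn, alternatingWord_succ] at e
          have h1 := hω.eq
          rw [e, wordProd_concat, wordProd_concat, simple_mul_simple_cancel_right] at h1
          have h2 := cs.length_wordProd_le (alternatingWord k a m)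
          rw [List.length_concat, List.length_concat] at h1
          omega
    have hk := h k (by simp)
    rw [List.length_concat]
    rcases ih hω.of_concat fun l hl => h l (by simp [hl]) with e | e
    · exact (aux e hk).symm
    · exact aux e hk.symm

-- The equality says `(s_i s_j)^n = 1`, so `m` divides `n`; alternating words longer than `m` are
-- not reduced, so `n ≤ m`.
variable {cs} in
theorem eq_of_wordProd_alternatingWord_eq {i j : B} {n : ℕ}
    (hn : n ≠ 0) (hred : cs.IsReduced (alternatingWord i j n))
    (h : cs.wordProd (alternatingWord i j n) = cs.wordProd (alternatingWord j i n)) :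
    n = M i j := by
  have hpow : (cs.simple i * cs.simple j) ^ n = 1 := by
    have hinv : (cs.simple j * cs.simple i) ^ (n / 2) =
        ((cs.simple i * cs.simple j) ^ (n / 2))⁻¹ := by
      rw [← inv_pow, mul_inv_rev, inv_simple, inv_simple]
    rw [prod_alternatingWord_eq_mul_pow, prod_alternatingWord_eq_mul_pow, hinv] at h
    obtain ⟨k, rfl | rfl⟩ := Nat.even_or_odd' n
    · rw [show 2 * k / 2 = k by omega] at h
      simp only [even_two, Even.mul_right, if_true, one_mul] at h
      rw [two_mul, pow_add, mul_eq_one_iff_eq_inv]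
      exact h
    · rw [show (2 * k + 1) / 2 = k by omega] at h
      have hodd : ¬ Even (2 * k + 1) := by simp [parity_simps]
      simp only [hodd, if_false] at h
      rw [eq_mul_inv_iff_mul_eq] at h
      rw [show 2 * k + 1 = k + k + 1 by ring, pow_succ', pow_add, mul_assoc, ← mul_assoc (cs.simple j),
        h, simple_mul_simple_self]
  have hdvd : M i j ∣ n := by
    rw [← cs.orderOf_simple_mul_simple]
    exact orderOf_dvd_of_pow_eq_one hpow
  have h0 : M i j ≠ 0 := by
    intro h0
    rw [h0, zero_dvd_iff] at hdvd
    exact hn hdvd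
  refine le_antisymm ?_ (Nat.le_of_dvd (Nat.pos_of_ne_zero hn) hdvd)
  by_contra hlt
  exact cs.not_isReduced_alternatingWord i j h0 (not_le.mp hlt) hred

/-- An element with two distinct right descents `i` and `j` ends with a braid word. -/
theorem exists_eq_mul_braidWord {w : W} {i j : B} (hij : i ≠ j) (hi : cs.IsRightDescent w i)
    (hj : cs.IsRightDescent w j) :
    M i j ≠ 0 ∧ ∃ ζ, w = cs.wordProd (ζ ++ alternatingWord i j (M i j)) ∧
      cs.IsReduced (ζ ++ alternatingWord i j (M i j)) := by
  obtain ⟨u, hu, hmin⟩ := cs.exists_isMinimal {i, j} w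
  set y := u⁻¹ with hy
  have hyY : y ∈ cs.parabolic {i, j} := inv_mem hu
  set d := w * u with hd
  have hw : w = d * y := by rw [hd, hy, mul_inv_cancel_right]
  clear_value d y
  subst hw
  -- Lengths add in `d * y`, so `y` inherits both descents. It thus has two alternating reduced
  -- words with different last letters, which forces length `M i j`.
  have desc : ∀ k ∈ ({i, j} : Set B), cs.IsRightDescent (d * y) k → ∃ γ : List B,
      (∀ l ∈ γ, l ∈ ({i, j} : Set B)) ∧ cs.IsReduced (γ.concat k) ∧ cs.wordProd (γ.concat k) = y := by
    intro k hk h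
    have hyk := mul_mem hyY (cs.simple_mem_parabolic hk)
    rw [isRightDescent_iff, mul_assoc, hmin.length_mul hyk, hmin.length_mul hyY] at h
    obtain ⟨γ, hγ, hγ', e⟩ := cs.exists_isReduced_of_mem_parabolic hyk
    have e' : cs.wordProd (γ.concat k) = y := by
      rw [wordProd_concat, ← e, simple_mul_simple_cancel_right]
    refine ⟨γ, hγ', ?_, e'⟩
    rw [IsReduced, e', List.length_concat, ← hγ.eq, ← e]
    omega
  have alt : ∀ a b : B, a ≠ b → ∀ γ : List B, (∀ l ∈ γ, l = a ∨ l = b) →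
      cs.IsReduced (γ.concat b) → γ.concat b = alternatingWord a b (γ.length + 1) := by
    intro a b hab γ hγ hred
    rcases hred.eq_alternatingWord (i := a) (j := b) (by
      intro k hk
      rw [List.concat_eq_append, List.mem_append, List.mem_singleton] at hk
      exact hk.elim (hγ k) Or.inr) with h | h <;> rw [List.length_concat] at h
    · exact h
    · rw [alternatingWord_succ b a, List.concat_eq_append, List.concat_eq_append] at h
      exact absurd (List.append_singleton_inj.mp h).2.symm hab
  obtain ⟨γ, hγ, hγr, eγ⟩ := desc j (by simp) hj
  obtain ⟨γ', hγ', hγr', eγ'⟩ := desc i (by simp) hi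
  have hlen : γ.length + 1 = γ'.length + 1 := by
    rw [← List.length_concat (a := j), ← hγr.eq, eγ, ← eγ', hγr'.eq, List.length_concat]
  have e := alt i j hij γ (fun l hl => hγ l hl) hγr
  have e' := alt j i hij.symm γ' (fun l hl => (hγ' l hl).symm) hγr'
  rw [e] at hγr eγ
  rw [e', ← hlen] at hγr' eγ'
  have hm : γ.length + 1 = M i j :=
    eq_of_wordProd_alternatingWord_eq (Nat.succ_ne_zero _) hγr (eγ.trans eγ'.symm)
  rw [hm] at hγr eγ
  obtain ⟨ζ, hζ, rfl⟩ := cs.exists_isReduced d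
  refine ⟨by omega, ζ, by rw [wordProd_append, eγ], ?_⟩
  rw [IsReduced, wordProd_append, eγ, hmin.length_mul hyY, hζ.eq, ← eγ, hγr.eq, List.length_append]

/-- Matsumoto's theorem: a map satisfying the braid relations takes the same value on all reduced
words of an element. -/
theorem prod_map_eq_of_isReduced {G : Type*} [Monoid G] {f : B → G}
    (hf : ∀ i j, ((braidWord M i j).map f).prod = ((braidWord M j i).map f).prod)
    {ω ω' : List B} (hω : cs.IsReduced ω) (hω' : cs.IsReduced ω')
    (h : cs.wordProd ω = cs.wordProd ω') : (ω.map f).prod = (ω'.map f).prod := by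
  have hlen : ω.length = ω'.length := by rw [← hω.eq, h, hω'.eq]
  induction hn : ω.length generalizing ω ω' with
  | zero =>
    rw [hn] at hlen
    rw [List.eq_nil_of_length_eq_zero hn, List.eq_nil_of_length_eq_zero hlen.symm]
  | succ n ih =>
    obtain ⟨α, i, rfl⟩ : ∃ (α : List B) (i : B), ω = α.concat i := by
      rcases List.eq_nil_or_concat ω with h | h
      · simp [h] at hn
      · exact h
    obtain ⟨β, j, rfl⟩ : ∃ (β : List B) (j : B), ω' = β.concat j := by
      rcases List.eq_nil_or_concat ω' with h | h
      · simp [h] at hlen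
      · exact h
    rw [List.length_concat, List.length_concat] at hlen
    rw [List.length_concat] at hn
    have desc : ∀ {α : List B} {i : B}, cs.IsReduced (α.concat i) →
        cs.IsRightDescent (cs.wordProd (α.concat i)) i := by
      intro α i hα
      rw [isRightDescent_iff, hα.eq, wordProd_concat, simple_mul_simple_cancel_right,
        hα.of_concat.eq, List.length_concat]
    rcases eq_or_ne i j with rfl | hij
    · rw [wordProd_concat, wordProd_concat, mul_right_cancel_iff] at h
      simp only [List.concat_eq_append, List.map_append, List.prod_append]
      rw [ih hω.of_concat hω'.of_concat h (by omega) (by omega)]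
    · obtain ⟨h0, ζ, e, hred⟩ := cs.exists_eq_mul_braidWord hij (desc hω) (h ▸ desc hω')
      obtain ⟨m, hm⟩ := Nat.exists_eq_succ_of_ne_zero h0
      -- Each of the two words shares its last letter with `ζ` followed by one of the two braid
      -- words, so induction on the shorter words compares them; `hf` then swaps the braid words.
      have key : ∀ {a b : B} {α : List B}, M a b = m + 1 → α.length = n → cs.IsReduced (α.concat b) →
          cs.wordProd (α.concat b) = cs.wordProd (ζ ++ alternatingWord a b (M a b)) →
          cs.IsReduced (ζ ++ alternatingWord a b (M a b)) →
          ((α.concat b).map f).prod = (ζ.map f).prod * ((alternatingWord a b (M a b)).map f).prod := by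
        intro a b α hab hα hαr e hr
        have happ : ζ ++ alternatingWord a b (M a b) = (ζ ++ alternatingWord b a m).concat b := by
          rw [hab, alternatingWord_succ]
          simp
        rw [happ] at e hr
        have hl : α.length = (ζ ++ alternatingWord b a m).length := by
          have := congrArg cs.length e
          rw [hαr.eq, hr.eq, List.length_concat, List.length_concat] at this
          omega
        rw [wordProd_concat, wordProd_concat, mul_right_cancel_iff] at e
        have := ih hαr.of_concat hr.of_concat e hl hα
        rw [hab, alternatingWord_succ]
        simp only [List.concat_eq_append, List.map_append, List.prod_append] at this ⊢
        rw [this, mul_assoc]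
      have hbr : cs.wordProd (ζ ++ alternatingWord i j (M i j)) =
          cs.wordProd (ζ ++ alternatingWord j i (M j i)) := by
        rw [wordProd_append, wordProd_append, cs.wordProd_braidWord_eq i j]
      have hred' : cs.IsReduced (ζ ++ alternatingWord j i (M j i)) := by
        rw [IsReduced, ← hbr, hred.eq]
        simp [M.symmetric j i]
      rw [key (M.symmetric i j ▸ hm) (by omega) hω (e.trans hbr) hred',
        key hm (by omega) hω' (h.symm.trans e) hred, hf]

end CoxeterSystem

namespace CoxeterMatrix

theorem artinGen_braidWord {I : Type*} (M : CoxeterMatrix I) (i j : I) :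
    ((CoxeterSystem.braidWord M i j).map M.artinGen).prod =
      ((CoxeterSystem.braidWord M j i).map M.artinGen).prod := by
  have h : PresentedGroup.mk (Set.range (Function.uncurry M.braidRelator)) (M.braidRelator i j) = 1 :=
    (QuotientGroup.eq_one_iff _).mpr (Subgroup.subset_normalClosure ⟨(i, j), rfl⟩)
  rw [braidRelator, map_mul, map_inv, mul_inv_eq_one, map_list_prod, map_list_prod, List.map_map,
    List.map_map] at h
  exact h

end CoxeterMatrix

/-! ### The action of the Artin-Tits group on `W/W_X × A`. -/

namespace CoxeterSystem

variable {B W : Type*} [Group W] {M : CoxeterMatrix B} (cs : CoxeterSystem M W)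

theorem exists_isMinimal_mk_eq (X : Set B) (p : W ⧸ cs.parabolic X) :
    ∃ d : W, (d : W ⧸ cs.parabolic X) = p ∧ cs.IsMinimal X d := by
  obtain ⟨w, rfl⟩ := QuotientGroup.mk_surjective p
  obtain ⟨u, hu, h⟩ := cs.exists_isMinimal X w
  exact ⟨w * u, by rw [QuotientGroup.mk_mul_of_mem _ hu], h⟩

/-- The element of minimal length in a coset of a standard parabolic subgroup. -/
noncomputable def cosetRep (X : Set B) (p : W ⧸ cs.parabolic X) : W :=
  (cs.exists_isMinimal_mk_eq X p).choose

@[simp]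
theorem mk_cosetRep (X : Set B) (p : W ⧸ cs.parabolic X) :
    (cs.cosetRep X p : W ⧸ cs.parabolic X) = p :=
  (cs.exists_isMinimal_mk_eq X p).choose_spec.1

theorem isMinimal_cosetRep (X : Set B) (p : W ⧸ cs.parabolic X) :
    cs.IsMinimal X (cs.cosetRep X p) :=
  (cs.exists_isMinimal_mk_eq X p).choose_spec.2

variable {cs} in
theorem IsMinimal.cosetRep_eq {X : Set B} {d : W} (hd : cs.IsMinimal X d)
    {p : W ⧸ cs.parabolic X} (h : (d : W ⧸ cs.parabolic X) = p) : cs.cosetRep X p = d := by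
  rw [← cs.mk_cosetRep X p, QuotientGroup.eq] at h
  have h1 := hd.eq_one h (by simpa using cs.isMinimal_cosetRep X p)
  exact (inv_mul_eq_one.mp h1).symm

theorem cosetRep_one (X : Set B) : cs.cosetRep X ((1 : W) : W ⧸ cs.parabolic X) = 1 :=
  (cs.isMinimal_one X).cosetRep_eq rfl

theorem smul_eq_self {X : Set B} {p : W ⧸ cs.parabolic X} {i x : B} (hx : x ∈ X)
    (h : cs.simple i * cs.cosetRep X p = cs.cosetRep X p * cs.simple x) :
    cs.simple i • p = p := by
  conv_lhs => rw [← cs.mk_cosetRep X p]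
  rw [MulAction.Quotient.smul_mk, smul_eq_mul, h,
    QuotientGroup.mk_mul_of_mem _ (cs.simple_mem_parabolic hx), mk_cosetRep]

theorem cosetRep_simple_smul {X : Set B} {p : W ⧸ cs.parabolic X} {i : B}
    (h : ¬ ∃ x ∈ X, cs.simple i * cs.cosetRep X p = cs.cosetRep X p * cs.simple x) :
    cs.cosetRep X (cs.simple i • p) = cs.simple i * cs.cosetRep X p := by
  apply (((cs.isMinimal_cosetRep X p).simple_mul i).resolve_right h).cosetRep_eq
  conv_rhs => rw [← cs.mk_cosetRep X p]
  rfl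

open Classical in
/-- The contribution of the generator `σ_i` acting on the coset `p`: if `s_i p = p`, so that
`s_i d = d s_x` for the minimal representative `d` of `p` and some `x ∈ X`, it is `σ_x`, and
otherwise it is trivial. -/
noncomputable def cosetFactor (X : Set B) (p : W ⧸ cs.parabolic X) (i : B) : M.ArtinGroup :=
  if h : ∃ x ∈ X, cs.simple i * cs.cosetRep X p = cs.cosetRep X p * cs.simple x then
    M.artinGen h.choose else 1

theorem cosetFactor_eq {X : Set B} {p : W ⧸ cs.parabolic X} {i x : B} (hx : x ∈ X)
    (h : cs.simple i * cs.cosetRep X p = cs.cosetRep X p * cs.simple x) :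
    cs.cosetFactor X p i = M.artinGen x := by
  have h' : ∃ x ∈ X, cs.simple i * cs.cosetRep X p = cs.cosetRep X p * cs.simple x := ⟨x, hx, h⟩
  rw [cosetFactor, dif_pos h']
  have := h'.choose_spec.2
  rw [← cs.simple_injective (mul_left_cancel (h.symm.trans this))]

theorem cosetFactor_eq_one {X : Set B} {p : W ⧸ cs.parabolic X} {i : B}
    (h : ¬ ∃ x ∈ X, cs.simple i * cs.cosetRep X p = cs.cosetRep X p * cs.simple x) :
    cs.cosetFactor X p i = 1 := by
  rw [cosetFactor, dif_neg h]

/-- The permutation of `W/W_X × A` by which `σ_i` acts. -/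
noncomputable def cosetPerm (X : Set B) (i : B) :
    Equiv.Perm ((W ⧸ cs.parabolic X) × M.ArtinGroup) where
  toFun q := (cs.simple i • q.1, cs.cosetFactor X q.1 i * q.2)
  invFun q := (cs.simple i • q.1, (cs.cosetFactor X (cs.simple i • q.1) i)⁻¹ * q.2)
  left_inv q := by simp [smul_smul]
  right_inv q := by simp [smul_smul]

/-- The contribution of a word acting on the coset `p`. -/
noncomputable def wordFactor (X : Set B) (p : W ⧸ cs.parabolic X) : List B → M.ArtinGroup
  | [] => 1
  | i :: ω => cs.cosetFactor X (cs.wordProd ω • p) i * wordFactor X p ω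

theorem cosetPerm_prod (X : Set B) (ω : List B) (p : W ⧸ cs.parabolic X) (g : M.ArtinGroup) :
    (ω.map (cs.cosetPerm X)).prod (p, g) = (cs.wordProd ω • p, cs.wordFactor X p ω * g) := by
  induction ω with
  | nil => simp [wordFactor]
  | cons i ω ih =>
    rw [List.map_cons, List.prod_cons, Equiv.Perm.mul_apply, ih, wordProd_cons]
    simp [cosetPerm, wordFactor, mul_smul, mul_assoc]

theorem wordFactor_append (X : Set B) (ω ω' : List B) (p : W ⧸ cs.parabolic X) :
    cs.wordFactor X p (ω ++ ω') =
      cs.wordFactor X (cs.wordProd ω' • p) ω * cs.wordFactor X p ω' := by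
  induction ω with
  | nil => simp [wordFactor]
  | cons i ω ih => simp [wordFactor, ih, wordProd_append, mul_smul, mul_assoc]

/-- The minimal representative of a coset in the `W_Y`-orbit of `p` lies in `W_Y d`, where
`d` is the minimal representative of `p`. -/
theorem cosetRep_simple_smul_mem {X Y : Set B} {p : W ⧸ cs.parabolic X} {d : W} {y : B} (hy : y ∈ Y)
    (h : cs.cosetRep X p * d⁻¹ ∈ cs.parabolic Y) :
    cs.cosetRep X (cs.simple y • p) * d⁻¹ ∈ cs.parabolic Y := by
  by_cases hx : ∃ x ∈ X, cs.simple y * cs.cosetRep X p = cs.cosetRep X p * cs.simple x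
  · obtain ⟨x, hx, e⟩ := hx
    rwa [cs.smul_eq_self hx e]
  · rw [cs.cosetRep_simple_smul hx, mul_assoc]
    exact mul_mem (cs.simple_mem_parabolic hy) h

theorem conj_simple_mem_parabolic {Y : Set B} {d v : W} {x y : B} (hy : y ∈ Y)
    (hv : v * d⁻¹ ∈ cs.parabolic Y) (h : cs.simple y * v = v * cs.simple x) :
    d * cs.simple x * d⁻¹ ∈ cs.parabolic Y := by
  have : d * cs.simple x * d⁻¹ = (v * d⁻¹)⁻¹ * cs.simple y * (v * d⁻¹) := by
    rw [mul_assoc (v * d⁻¹)⁻¹, ← mul_assoc (cs.simple y), h]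
    group
  rw [this]
  exact mul_mem (mul_mem (inv_mem hv) (cs.simple_mem_parabolic hy)) hv

/-- If all nontrivial contributions are the same generator `σ_x`, then the contribution of a word
is a power of `σ_x`, with an exponent read off the inversion sequence. -/
theorem wordFactor_eq_pow [DecidableEq W] {X Y : Set B} {p : W ⧸ cs.parabolic X} {x : B}
    (hxX : x ∈ X)
    (h : ∀ ω : List B, (∀ k ∈ ω, k ∈ Y) → ∀ k ∈ Y, ∀ z ∈ X,
      cs.simple k * cs.cosetRep X (cs.wordProd ω • p) =
        cs.cosetRep X (cs.wordProd ω • p) * cs.simple z → z = x)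
    (ω : List B) (hω : ∀ k ∈ ω, k ∈ Y) :
    cs.wordFactor X p ω = M.artinGen x ^ (cs.rightInvSeq ω).count
      (cs.cosetRep X p * cs.simple x * (cs.cosetRep X p)⁻¹) := by
  set v := cs.cosetRep X p with hv
  set t := v * cs.simple x * v⁻¹ with ht
  -- The second identity is the invariant of the induction: each contribution of `σ_x` is the factor
  -- `s_x` by which `ω v` departs from the minimal representative of its coset.
  suffices cs.wordFactor X p ω = M.artinGen x ^ (cs.rightInvSeq ω).count t ∧
      cs.cosetRep X (cs.wordProd ω • p) * cs.simple x ^ (cs.rightInvSeq ω).count t =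
        cs.wordProd ω * v from this.1
  induction ω with
  | nil => simp [wordFactor, hv]
  | cons i ω ih =>
    obtain ⟨ih1, ih2⟩ := ih fun k hk => hω k (by simp [hk])
    have hω' : ∀ k ∈ ω, k ∈ Y := fun k hk => hω k (by simp [hk])
    have hi := hω i (by simp)
    set n := (cs.rightInvSeq ω).count t with hn
    set q := cs.wordProd ω • p with hq
    have hiff : (cs.simple i * cs.cosetRep X q = cs.cosetRep X q * cs.simple x) ↔
        (cs.wordProd ω)⁻¹ * cs.simple i * cs.wordProd ω = t := by
      have e : cs.cosetRep X q = cs.wordProd ω * v * (cs.simple x ^ n)⁻¹ := by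
        rw [← ih2]; group
      have comm : (cs.simple x ^ n)⁻¹ * cs.simple x = cs.simple x * (cs.simple x ^ n)⁻¹ :=
        ((Commute.refl (cs.simple x)).pow_left n).inv_left.eq
      rw [e, mul_assoc _ _ (cs.simple x), comm, ← mul_assoc, ← mul_assoc, ← mul_assoc,
        mul_right_cancel_iff, ht]
      rw [eq_mul_inv_iff_mul_eq]
      simp only [mul_assoc]
      rw [inv_mul_eq_iff_eq_mul]
    rw [rightInvSeq, List.count_cons, ← hn, wordFactor, ih1, ← hq, wordProd_cons, mul_smul, ← hq]
    by_cases hx : cs.simple i * cs.cosetRep X q = cs.cosetRep X q * cs.simple x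
    · rw [if_pos (by simpa using hiff.mp hx), cs.cosetFactor_eq hxX hx, pow_succ',
        cs.smul_eq_self hxX hx, pow_succ', ← mul_assoc _ (cs.simple x), ← hx, mul_assoc, ih2,
        mul_assoc]
      exact ⟨rfl, rfl⟩
    · have hne : ¬ ∃ z ∈ X, cs.simple i * cs.cosetRep X q = cs.cosetRep X q * cs.simple z := by
        rintro ⟨z, hz, e⟩
        have := h ω hω' i hi z hz e
        subst this
        exact hx e
      rw [if_neg (by simpa using fun h => hx (hiff.mpr h)), cs.cosetFactor_eq_one hne,
        cs.cosetRep_simple_smul hne, one_mul, add_zero, mul_assoc, ih2, mul_assoc]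
      exact ⟨rfl, rfl⟩

/-- Both generators fix the coset `p`, so the contributions are the same at every step. -/
theorem wordFactor_alternatingWord {X : Set B} {p : W ⧸ cs.parabolic X} {i j x x' : B} (hx : x ∈ X)
    (hx' : x' ∈ X) (h : cs.simple i * cs.cosetRep X p = cs.cosetRep X p * cs.simple x)
    (h' : cs.simple j * cs.cosetRep X p = cs.cosetRep X p * cs.simple x') (n : ℕ) :
    cs.wordFactor X p (alternatingWord i j n) = ((alternatingWord x x' n).map M.artinGen).prod := by
  induction n generalizing i j x x' with
  | zero => rfl
  | succ n ih =>
    rw [alternatingWord_succ, alternatingWord_succ, List.concat_eq_append, List.concat_eq_append,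
      wordFactor_append, wordProd_singleton, cs.smul_eq_self hx' h', ih hx' hx h' h]
    simp [wordFactor, cs.cosetFactor_eq hx' h']

/-- Let `d` be the shortest element of `W_Y v`, with `Y = {i, j}`. A contribution `σ_z` can occur
only if `d s_z d⁻¹` is `s_i` or `s_j`. If both arise, then `v = d` and the two words become the
braid words of `x, x'`, with `m(x, x') = m(i, j)`. Otherwise at most one generator `σ_x`
contributes, with an exponent counted in the inversion sequence, which is the same up to order for
both words. -/
theorem wordFactor_braidWord (X : Set B) (p : W ⧸ cs.parabolic X) (i j : B) :
    cs.wordFactor X p (braidWord M i j) = cs.wordFactor X p (braidWord M j i) := by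
  classical
  set Y : Set B := {i, j} with hY
  have halt : ∀ n : ℕ, ∀ a ∈ Y, ∀ b ∈ Y, ∀ k ∈ alternatingWord a b n, k ∈ Y := by
    intro n
    induction n with
    | zero => simp [alternatingWord]
    | succ n ih =>
      intro a ha b hb k hk
      rw [alternatingWord_succ, List.concat_eq_append, List.mem_append, List.mem_singleton] at hk
      rcases hk with hk | rfl
      · exact ih b hb a ha k hk
      · exact hb
  have hiY : i ∈ Y := by simp [hY]
  have hjY : j ∈ Y := by simp [hY]
  set v := cs.cosetRep X p with hv
  obtain ⟨r, hr, hd⟩ := cs.exists_isMinimal Y v⁻¹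
  set d := r⁻¹ * v with hd_def
  have hd' : cs.IsMinimal Y d⁻¹ := by rwa [hd_def, mul_inv_rev, inv_inv]
  have hvd : v = r * d := by rw [hd_def]; group
  have hdX : cs.IsMinimal X d := hd'.of_mul hr (hvd ▸ cs.isMinimal_cosetRep X p)
  have orbit : ∀ ω : List B, (∀ k ∈ ω, k ∈ Y) →
      cs.cosetRep X (cs.wordProd ω • p) * d⁻¹ ∈ cs.parabolic Y := by
    intro ω hω
    induction ω with
    | nil => simpa [← hv, hvd] using hr
    | cons k ω ih =>
      rw [wordProd_cons, mul_smul]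
      exact cs.cosetRep_simple_smul_mem (hω k (by simp)) (ih fun l hl => hω l (by simp [hl]))
  have fixed : ∀ ω : List B, (∀ k ∈ ω, k ∈ Y) → ∀ k ∈ Y, ∀ z ∈ X,
      cs.simple k * cs.cosetRep X (cs.wordProd ω • p) =
        cs.cosetRep X (cs.wordProd ω • p) * cs.simple z →
      ∃ y ∈ Y, d * cs.simple z * d⁻¹ = cs.simple y := by
    intro ω hω k hk z hz e
    exact hdX.exists_simple_eq_conj hd' hz (cs.conj_simple_mem_parabolic hk (orbit ω hω) e)
  by_cases hA : (∃ x ∈ X, d * cs.simple x * d⁻¹ = cs.simple i) ∧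
      ∃ x ∈ X, d * cs.simple x * d⁻¹ = cs.simple j
  · obtain ⟨⟨x, hx, ex⟩, x', hx', ex'⟩ := hA
    -- Now `d⁻¹ W_Y d ⊆ W_X`, so `v = r d` and `d` are minimal in the same coset of `W_X`.
    have hconj : d⁻¹ * r * d ∈ cs.parabolic X := by
      have hle : cs.parabolic Y ≤ (cs.parabolic X).comap (MulAut.conj d⁻¹).toMonoidHom := by
        rw [parabolic, Subgroup.closure_le]
        rintro _ ⟨y, rfl | rfl, rfl⟩
        · rw [← ex]
          simpa [mul_assoc] using cs.simple_mem_parabolic hx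
        · rw [← ex']
          simpa [mul_assoc] using cs.simple_mem_parabolic hx'
      simpa using hle hr
    have hvd' : v = d := by
      have hv' : d * (d⁻¹ * r * d) = v := by rw [hvd]; group
      have h1 := hdX.eq_one hconj (hv' ▸ cs.isMinimal_cosetRep X p)
      rw [← hv', h1, mul_one]
    rw [← hvd', mul_inv_eq_iff_eq_mul] at ex ex'
    have hM : M x x' = M i j := by
      rw [← cs.orderOf_simple_mul_simple i j, ← cs.orderOf_simple_mul_simple x x',
        ← MulEquiv.orderOf_eq (MulAut.conj v)]
      congr 1
      rw [MulAut.conj_apply, ← mul_assoc, ex, mul_assoc (cs.simple i), ex']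
      group
    rw [cs.wordFactor_alternatingWord hx hx' ex.symm ex'.symm,
      cs.wordFactor_alternatingWord hx' hx ex'.symm ex.symm, M.symmetric j i, ← hM]
    have := M.artinGen_braidWord x x'
    rwa [braidWord, braidWord, M.symmetric x' x] at this
  · obtain ⟨x, hx⟩ : ∃ x, ∀ z ∈ X, (∃ y ∈ Y, d * cs.simple z * d⁻¹ = cs.simple y) → z = x := by
      by_cases hex : ∃ x ∈ X, ∃ y ∈ Y, d * cs.simple x * d⁻¹ = cs.simple y
      · obtain ⟨x, hxX, y, hy, e⟩ := hex
        refine ⟨x, ?_⟩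
        rintro z hz ⟨y', hy', e'⟩
        have : y = y' := by
          rcases hy with rfl | rfl <;> rcases hy' with rfl | rfl
          · rfl
          · exact absurd ⟨⟨x, hxX, e⟩, z, hz, e'⟩ hA
          · exact absurd ⟨⟨z, hz, e'⟩, x, hxX, e⟩ hA
          · rfl
        subst this
        rw [← e] at e'
        exact cs.simple_injective (mul_left_cancel (mul_right_cancel e'))
      · exact ⟨i, fun z hz h => absurd ⟨z, hz, h⟩ hex⟩
    by_cases hxX : x ∈ X
    · have key := cs.wordFactor_eq_pow (Y := Y) hxX fun ω hω k hk z hz e =>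
        hx z hz (fixed ω hω k hk z hz e)
      rw [key _ (halt _ i hiY j hjY), key _ (halt _ j hjY i hiY),
        (cs.rightInvSeq_braidWord_perm i j).count_eq]
    · have key : ∀ ω : List B, (∀ k ∈ ω, k ∈ Y) → cs.wordFactor X p ω = 1 := by
        intro ω hω
        induction ω with
        | nil => rfl
        | cons k ω ih =>
          have hω' : ∀ l ∈ ω, l ∈ Y := fun l hl => hω l (by simp [hl])
          rw [wordFactor, ih hω', mul_one, cosetFactor_eq_one]
          rintro ⟨z, hz, e⟩
          exact hxX (hx z hz (fixed ω hω' k (hω k (by simp)) z hz e) ▸ hz)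
      rw [key _ (halt _ i hiY j hjY), key _ (halt _ j hjY i hiY)]

theorem lift_cosetPerm_braidRelator (X : Set B) :
    ∀ r ∈ Set.range (Function.uncurry M.braidRelator), FreeGroup.lift (cs.cosetPerm X) r = 1 := by
  rintro _ ⟨⟨i, j⟩, rfl⟩
  have hl : ∀ l : List B, FreeGroup.lift (cs.cosetPerm X) (l.map FreeGroup.of).prod =
      (l.map (cs.cosetPerm X)).prod := by
    intro l
    rw [map_list_prod, List.map_map]
    congr 2
  rw [Function.uncurry, CoxeterMatrix.braidRelator, map_mul, map_inv, hl, hl, mul_inv_eq_one]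
  ext1 ⟨p, g⟩
  rw [cosetPerm_prod, cosetPerm_prod, wordFactor_braidWord, wordProd_braidWord_eq]

/-- The action of the Artin-Tits group on `W/W_X × A`. -/
noncomputable def cosetAction (X : Set B) :
    M.ArtinGroup →* Equiv.Perm ((W ⧸ cs.parabolic X) × M.ArtinGroup) :=
  PresentedGroup.toGroup (cs.lift_cosetPerm_braidRelator X)

theorem cosetAction_artinGen (X : Set B) (i : B) :
    cs.cosetAction X (M.artinGen i) = cs.cosetPerm X i :=
  PresentedGroup.toGroup.of _

end CoxeterSystem

/-! ### Properties of the action. -/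

namespace CoxeterMatrix

variable {I : Type*} (M : CoxeterMatrix I)

theorem artinGen_mem_standardParabolic {X : Set I} {x : I} (hx : x ∈ X) :
    M.artinGen x ∈ M.standardParabolic X :=
  Subgroup.subset_closure ⟨x, hx, rfl⟩

theorem standardParabolic_mono {X Y : Set I} (h : X ⊆ Y) :
    M.standardParabolic X ≤ M.standardParabolic Y :=
  Subgroup.closure_mono (Set.image_mono h)

theorem mem_standardParabolic_univ (a : M.ArtinGroup) : a ∈ M.standardParabolic Set.univ := by
  have h := PresentedGroup.closure_range_of (Set.range (Function.uncurry M.braidRelator))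
  rw [standardParabolic, Set.image_univ]
  change a ∈ Subgroup.closure (Set.range PresentedGroup.of)
  rw [h]
  trivial

theorem artinToCoxeter_cosetFactor (X : Set I) (p : M.Group ⧸ M.toCoxeterSystem.parabolic X)
    (i : I) :
    M.toCoxeterSystem.cosetRep X (M.toCoxeterSystem.simple i • p) *
      M.artinToCoxeter (M.toCoxeterSystem.cosetFactor X p i) =
    M.toCoxeterSystem.simple i * M.toCoxeterSystem.cosetRep X p := by
  by_cases h : ∃ x ∈ X, M.toCoxeterSystem.simple i * M.toCoxeterSystem.cosetRep X p =
      M.toCoxeterSystem.cosetRep X p * M.toCoxeterSystem.simple x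
  · obtain ⟨x, hx, e⟩ := h
    rw [M.toCoxeterSystem.cosetFactor_eq hx e, M.toCoxeterSystem.smul_eq_self hx e,
      artinToCoxeter_artinGen, e]
    rfl
  · rw [M.toCoxeterSystem.cosetFactor_eq_one h, M.toCoxeterSystem.cosetRep_simple_smul h, map_one,
      mul_one]

theorem cosetFactor_mem (X : Set I) (p : M.Group ⧸ M.toCoxeterSystem.parabolic X) (i : I) :
    M.toCoxeterSystem.cosetFactor X p i ∈ M.standardParabolic X := by
  by_cases h : ∃ x ∈ X, M.toCoxeterSystem.simple i * M.toCoxeterSystem.cosetRep X p =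
      M.toCoxeterSystem.cosetRep X p * M.toCoxeterSystem.simple x
  · obtain ⟨x, hx, e⟩ := h
    rw [M.toCoxeterSystem.cosetFactor_eq hx e]
    exact M.artinGen_mem_standardParabolic hx
  · rw [M.toCoxeterSystem.cosetFactor_eq_one h]
    exact one_mem _

theorem cosetAction_artinGen_mul (X : Set I) (i : I) (a : M.ArtinGroup) (q) :
    M.toCoxeterSystem.cosetAction X (M.artinGen i * a) q =
      (M.toCoxeterSystem.simple i • (M.toCoxeterSystem.cosetAction X a q).1,
        M.toCoxeterSystem.cosetFactor X (M.toCoxeterSystem.cosetAction X a q).1 i *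
          (M.toCoxeterSystem.cosetAction X a q).2) := by
  rw [map_mul, CoxeterSystem.cosetAction_artinGen]
  rfl

theorem cosetAction_artinGen_inv_mul (X : Set I) (i : I) (a : M.ArtinGroup) (q) :
    M.toCoxeterSystem.cosetAction X ((M.artinGen i)⁻¹ * a) q =
      (M.toCoxeterSystem.simple i • (M.toCoxeterSystem.cosetAction X a q).1,
        (M.toCoxeterSystem.cosetFactor X
          (M.toCoxeterSystem.simple i • (M.toCoxeterSystem.cosetAction X a q).1) i)⁻¹ *
          (M.toCoxeterSystem.cosetAction X a q).2) := by
  rw [map_mul, map_inv, CoxeterSystem.cosetAction_artinGen]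
  rfl

theorem cosetAction_mul_right (X : Set I) (a : M.ArtinGroup) (p) (g h : M.ArtinGroup) :
    M.toCoxeterSystem.cosetAction X a (p, g * h) =
      ((M.toCoxeterSystem.cosetAction X a (p, g)).1,
        (M.toCoxeterSystem.cosetAction X a (p, g)).2 * h) := by
  induction M.mem_standardParabolic_univ a using Subgroup.closure_induction_left with
  | one => simp
  | mul_left _ hx a _ ih =>
    obtain ⟨i, -, rfl⟩ := hx
    simp only [cosetAction_artinGen_mul, ih, mul_assoc]
  | inv_mul_cancel _ hx a _ ih =>
    obtain ⟨i, -, rfl⟩ := hx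
    simp only [cosetAction_artinGen_inv_mul, ih, mul_assoc]

/-- The map `(p, g) ↦ d_p θ(g)` is equivariant along `θ`. This is what makes the conjugating element
`h` colored. -/
theorem cosetRep_cosetAction (X : Set I) (a : M.ArtinGroup) (q) :
    M.toCoxeterSystem.cosetRep X (M.toCoxeterSystem.cosetAction X a q).1 *
      M.artinToCoxeter (M.toCoxeterSystem.cosetAction X a q).2 =
    M.artinToCoxeter a * (M.toCoxeterSystem.cosetRep X q.1 * M.artinToCoxeter q.2) := by
  induction M.mem_standardParabolic_univ a using Subgroup.closure_induction_left with
  | one => simp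
  | mul_left _ hx a _ ih =>
    obtain ⟨i, -, rfl⟩ := hx
    simp only [cosetAction_artinGen_mul]
    rw [map_mul, ← mul_assoc, artinToCoxeter_cosetFactor, mul_assoc, ih, map_mul,
      artinToCoxeter_artinGen, mul_assoc]
    rfl
  | inv_mul_cancel _ hx a _ ih =>
    obtain ⟨i, -, rfl⟩ := hx
    simp only [cosetAction_artinGen_inv_mul]
    have h := M.artinToCoxeter_cosetFactor X
      (M.toCoxeterSystem.simple i • (M.toCoxeterSystem.cosetAction X a q).1) i
    rw [smul_smul, CoxeterSystem.simple_mul_simple_self, one_smul, ← eq_mul_inv_iff_mul_eq] at h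
    rw [h, mul_assoc] at ih
    rw [map_mul, map_inv, map_mul, map_inv, artinToCoxeter_artinGen, mul_assoc, ← ih]
    change _ = (M.toCoxeterSystem.simple i)⁻¹ * _
    rw [mul_assoc (M.toCoxeterSystem.simple i), inv_mul_cancel_left]

theorem cosetAction_fst (X : Set I) (a : M.ArtinGroup) (q) :
    (M.toCoxeterSystem.cosetAction X a q).1 = M.artinToCoxeter a • q.1 := by
  induction M.mem_standardParabolic_univ a using Subgroup.closure_induction_left with
  | one => simp
  | mul_left _ hx a _ ih =>
    obtain ⟨i, -, rfl⟩ := hx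
    rw [cosetAction_artinGen_mul, ih, map_mul, mul_smul, artinToCoxeter_artinGen]
    rfl
  | inv_mul_cancel _ hx a _ ih =>
    obtain ⟨i, -, rfl⟩ := hx
    rw [cosetAction_artinGen_inv_mul, ih, map_mul, mul_smul, map_inv, artinToCoxeter_artinGen,
      ← toCoxeterSystem_simple, CoxeterSystem.inv_simple]

theorem cosetAction_snd_mem (X : Set I) (a : M.ArtinGroup) {q} (hq : q.2 ∈ M.standardParabolic X) :
    (M.toCoxeterSystem.cosetAction X a q).2 ∈ M.standardParabolic X := by
  induction M.mem_standardParabolic_univ a using Subgroup.closure_induction_left with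
  | one => simpa
  | mul_left _ hx a _ ih =>
    obtain ⟨i, -, rfl⟩ := hx
    rw [cosetAction_artinGen_mul]
    exact mul_mem (M.cosetFactor_mem X _ i) ih
  | inv_mul_cancel _ hx a _ ih =>
    obtain ⟨i, -, rfl⟩ := hx
    rw [cosetAction_artinGen_inv_mul]
    exact mul_mem (inv_mem (M.cosetFactor_mem X _ i)) ih

theorem cosetAction_of_mem {X : Set I} {a : M.ArtinGroup} (ha : a ∈ M.standardParabolic X)
    (g : M.ArtinGroup) :
    M.toCoxeterSystem.cosetAction X a (((1 : M.Group) : M.Group ⧸ _), g) =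
      (((1 : M.Group) : M.Group ⧸ _), a * g) := by
  have h : ∀ x ∈ X, M.toCoxeterSystem.simple x *
      M.toCoxeterSystem.cosetRep X ((1 : M.Group) : M.Group ⧸ _) =
      M.toCoxeterSystem.cosetRep X ((1 : M.Group) : M.Group ⧸ _) * M.toCoxeterSystem.simple x := by
    intro x _
    rw [CoxeterSystem.cosetRep_one, one_mul, mul_one]
  induction ha using Subgroup.closure_induction_left with
  | one => simp
  | mul_left _ hx a _ ih =>
    obtain ⟨x, hx, rfl⟩ := hx
    rw [cosetAction_artinGen_mul, ih, CoxeterSystem.smul_eq_self _ hx (h x hx),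
      CoxeterSystem.cosetFactor_eq _ hx (h x hx), mul_assoc]
  | inv_mul_cancel _ hx a _ ih =>
    obtain ⟨x, hx, rfl⟩ := hx
    rw [cosetAction_artinGen_inv_mul, ih, CoxeterSystem.smul_eq_self _ hx (h x hx),
      CoxeterSystem.cosetFactor_eq _ hx (h x hx), mul_assoc]

/-! ### Intersections over a minimal double coset representative. -/

/-- The subset `X ∩ d⁻¹ Y d` of `X`, with indices identified with simple reflections. -/
def conjInter (X Y : Set I) (d : M.Group) : Set I :=
  {x ∈ X | ∃ y ∈ Y, d * M.toCoxeterSystem.simple x * d⁻¹ = M.toCoxeterSystem.simple y}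

/-- Along the `A_Y`-orbit the minimal representatives stay in `W_Y d`. A contributed `σ_x` therefore
has `d s_x d⁻¹ ∈ W_Y`, and minimality of `d` on both sides makes this conjugate a simple reflection.
-/
theorem cosetAction_mem_of_isMinimal {X Y : Set I} {d : M.Group}
    (hdX : M.toCoxeterSystem.IsMinimal X d) (hdY : M.toCoxeterSystem.IsMinimal Y d⁻¹)
    {b : M.ArtinGroup} (hb : b ∈ M.standardParabolic Y) (g : M.ArtinGroup) :
    (M.toCoxeterSystem.cosetAction X b ((d : M.Group ⧸ _), g)).2 * g⁻¹ ∈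
      M.standardParabolic (M.conjInter X Y d) := by
  have hfac : ∀ (p : M.Group ⧸ M.toCoxeterSystem.parabolic X), ∀ y ∈ Y,
      M.toCoxeterSystem.cosetRep X p * d⁻¹ ∈ M.toCoxeterSystem.parabolic Y →
      M.toCoxeterSystem.cosetFactor X p y ∈ M.standardParabolic (M.conjInter X Y d) := by
    intro p y hy hp
    by_cases h : ∃ x ∈ X, M.toCoxeterSystem.simple y * M.toCoxeterSystem.cosetRep X p =
      M.toCoxeterSystem.cosetRep X p * M.toCoxeterSystem.simple x
    · obtain ⟨x, hx, e⟩ := h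
      rw [M.toCoxeterSystem.cosetFactor_eq hx e]
      exact M.artinGen_mem_standardParabolic ⟨hx, hdX.exists_simple_eq_conj hdY hx
        (M.toCoxeterSystem.conj_simple_mem_parabolic hy hp e)⟩
    · rw [M.toCoxeterSystem.cosetFactor_eq_one h]
      exact one_mem _
  suffices M.toCoxeterSystem.cosetRep X
      (M.toCoxeterSystem.cosetAction X b ((d : M.Group ⧸ _), g)).1 * d⁻¹ ∈
        M.toCoxeterSystem.parabolic Y ∧
      (M.toCoxeterSystem.cosetAction X b ((d : M.Group ⧸ _), g)).2 * g⁻¹ ∈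
        M.standardParabolic (M.conjInter X Y d) from this.2
  induction hb using Subgroup.closure_induction_left with
  | one => simp [hdX.cosetRep_eq rfl, one_mem]
  | mul_left _ hx b _ ih =>
    obtain ⟨y, hy, rfl⟩ := hx
    rw [cosetAction_artinGen_mul, mul_assoc]
    exact ⟨M.toCoxeterSystem.cosetRep_simple_smul_mem hy ih.1, mul_mem (hfac _ y hy ih.1) ih.2⟩
  | inv_mul_cancel _ hx b _ ih =>
    obtain ⟨y, hy, rfl⟩ := hx
    rw [cosetAction_artinGen_inv_mul, mul_assoc]
    have h := M.toCoxeterSystem.cosetRep_simple_smul_mem hy ih.1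
    exact ⟨h, mul_mem (inv_mem (hfac _ y hy h)) ih.2⟩

/-- If `θ ω` is minimal in its double coset `W_Y (θ ω) W_X`, then `ω⁻¹ A_Y ω ∩ A_X` is contained in
a conjugate of a smaller standard parabolic subgroup, by a colored element of `A_X`. -/
theorem exists_conj_mem_of_isMinimal {X Y : Set I} {ω : M.ArtinGroup}
    (hX : M.toCoxeterSystem.IsMinimal X (M.artinToCoxeter ω))
    (hY : M.toCoxeterSystem.IsMinimal Y (M.artinToCoxeter ω)⁻¹) :
    ∃ h ∈ M.standardParabolic X, M.artinToCoxeter h = 1 ∧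
      ∀ a ∈ M.standardParabolic X, ω * a * ω⁻¹ ∈ M.standardParabolic Y →
        h * a * h⁻¹ ∈ M.standardParabolic (M.conjInter X Y (M.artinToCoxeter ω)) := by
  set q := M.toCoxeterSystem.cosetAction X ω (((1 : M.Group) : M.Group ⧸ _), 1) with hq
  have hq1 : q.1 = ((M.artinToCoxeter ω : M.Group) : M.Group ⧸ _) := by
    rw [hq, cosetAction_fst, MulAction.Quotient.smul_mk, smul_eq_mul, mul_one]
  refine ⟨q.2, M.cosetAction_snd_mem X ω (one_mem _), ?_, ?_⟩
  · have h := M.cosetRep_cosetAction X ω (((1 : M.Group) : M.Group ⧸ _), 1)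
    rw [← hq, hq1, hX.cosetRep_eq rfl, CoxeterSystem.cosetRep_one, map_one, mul_one, mul_one] at h
    simpa using h
  · intro a ha hb
    have h := M.cosetAction_mem_of_isMinimal hX hY hb q.2
    -- `ω⁻¹` returns to the base point, `a` translates there on the left, which at `1` is also a
    -- right translation, and right translations commute with `ω`.
    have e : M.toCoxeterSystem.cosetAction X (ω * a * ω⁻¹)
        (((M.artinToCoxeter ω : M.Group) : M.Group ⧸ _), q.2) = (q.1, q.2 * a) := by
      have h1 := M.cosetAction_mul_right X ω ((1 : M.Group) : M.Group ⧸ _) 1 a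
      rw [one_mul] at h1
      rw [← hq1, Prod.mk.eta, hq, ← Equiv.Perm.mul_apply, ← map_mul, inv_mul_cancel_right, map_mul,
        Equiv.Perm.mul_apply, M.cosetAction_of_mem ha, mul_one, h1]
    rwa [e] at h

theorem mem_conjSubgroup {g a : M.ArtinGroup} {H : Subgroup M.ArtinGroup} :
    a ∈ M.conjSubgroup g H ↔ g⁻¹ * a * g ∈ H := by
  rw [conjSubgroup, Subgroup.mem_map_equiv]
  simp

variable {M} in
theorem IsParabolic.conjSubgroup {P : Subgroup M.ArtinGroup} (hP : M.IsParabolic P)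
    (g : M.ArtinGroup) : M.IsParabolic (M.conjSubgroup g P) := by
  obtain ⟨X, h, rfl⟩ := hP
  refine ⟨X, g * h, ?_⟩
  ext a
  simp only [mem_conjSubgroup, mul_inv_rev, mul_assoc]

theorem exists_mem_standardParabolic {X : Set I} {u : M.Group}
    (hu : u ∈ M.toCoxeterSystem.parabolic X) :
    ∃ a ∈ M.standardParabolic X, M.artinToCoxeter a = u := by
  have h : M.toCoxeterSystem.parabolic X ≤ (M.standardParabolic X).map M.artinToCoxeter := by
    rw [CoxeterSystem.parabolic, Subgroup.closure_le]
    rintro _ ⟨x, hx, rfl⟩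
    exact ⟨M.artinGen x, M.artinGen_mem_standardParabolic hx, M.artinToCoxeter_artinGen x⟩
  exact h hu

theorem artinToCoxeter_prod (ω : List I) :
    M.artinToCoxeter (ω.map M.artinGen).prod = M.toCoxeterSystem.wordProd ω := by
  rw [map_list_prod, List.map_map]
  congr 1

/-- A lift to the Artin-Tits group of an element `d` of the Coxeter group that intertwines the
generators `σ_x` and `σ_y` whenever `d s_x = s_y d` and this has length `ℓ d + 1`. -/
theorem exists_lift_intertwining (d : M.Group) : ∃ δ : M.ArtinGroup, M.artinToCoxeter δ = d ∧
    ∀ x y, d * M.toCoxeterSystem.simple x = M.toCoxeterSystem.simple y * d →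
      M.toCoxeterSystem.length (d * M.toCoxeterSystem.simple x) = M.toCoxeterSystem.length d + 1 →
      δ * M.artinGen x = M.artinGen y * δ := by
  obtain ⟨ζ, hζ, rfl⟩ := M.toCoxeterSystem.exists_isReduced d
  refine ⟨(ζ.map M.artinGen).prod, M.artinToCoxeter_prod ζ, fun x y e hl => ?_⟩
  -- `ζ x` and `y ζ` are reduced words of the same element, so Matsumoto's theorem equates their
  -- lifts.
  have h1 : M.toCoxeterSystem.IsReduced (ζ.concat x) := by
    rw [CoxeterSystem.IsReduced, CoxeterSystem.wordProd_concat, hl, hζ.eq, List.length_concat]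
  have h2 : M.toCoxeterSystem.IsReduced (y :: ζ) := by
    rw [CoxeterSystem.IsReduced, CoxeterSystem.wordProd_cons, ← e, hl, hζ.eq, List.length_cons]
  have := M.toCoxeterSystem.prod_map_eq_of_isReduced M.artinGen_braidWord h1 h2
    (by rw [CoxeterSystem.wordProd_concat, CoxeterSystem.wordProd_cons, e])
  simpa using this

theorem exists_lift_conj_mem_iff {X Y : Set I} {d : M.Group}
    (hdX : M.toCoxeterSystem.IsMinimal X d) :
    ∃ δ : M.ArtinGroup, M.artinToCoxeter δ = d ∧ ∀ a,
      δ * a * δ⁻¹ ∈ M.standardParabolic (M.conjInter Y X d⁻¹) ↔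
        a ∈ M.standardParabolic (M.conjInter X Y d) := by
  obtain ⟨δ, hδ, h⟩ := M.exists_lift_intertwining d
  have hgen : ∀ x ∈ X, ∀ y ∈ Y,
      d * M.toCoxeterSystem.simple x * d⁻¹ = M.toCoxeterSystem.simple y →
      δ * M.artinGen x = M.artinGen y * δ := by
    intro x hx y hy e
    apply h x y (mul_inv_eq_iff_eq_mul.mp e)
    rw [hdX.length_mul (M.toCoxeterSystem.simple_mem_parabolic hx), CoxeterSystem.length_simple]
  have hle : M.standardParabolic (M.conjInter X Y d) ≤
      (M.standardParabolic (M.conjInter Y X d⁻¹)).comap (MulAut.conj δ).toMonoidHom := by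
    rw [standardParabolic, Subgroup.closure_le]
    rintro _ ⟨x, ⟨hx, y, hy, e⟩, rfl⟩
    have : δ * M.artinGen x * δ⁻¹ = M.artinGen y := by
      rw [hgen x hx y hy e, mul_inv_cancel_right]
    have hmem : M.artinGen y ∈ M.standardParabolic (M.conjInter Y X d⁻¹) :=
      M.artinGen_mem_standardParabolic ⟨hy, x, hx, by rw [← e]; group⟩
    simpa [this] using hmem
  have hle' : M.standardParabolic (M.conjInter Y X d⁻¹) ≤
      (M.standardParabolic (M.conjInter X Y d)).comap (MulAut.conj δ⁻¹).toMonoidHom := by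
    rw [standardParabolic, Subgroup.closure_le]
    rintro _ ⟨y, ⟨hy, x, hx, e⟩, rfl⟩
    have e' : d * M.toCoxeterSystem.simple x * d⁻¹ = M.toCoxeterSystem.simple y := by
      rw [← e]; group
    have : δ⁻¹ * M.artinGen y * δ = M.artinGen x := by
      rw [mul_assoc, ← hgen x hx y hy e', inv_mul_cancel_left]
    have hmem : M.artinGen x ∈ M.standardParabolic (M.conjInter X Y d) :=
      M.artinGen_mem_standardParabolic ⟨hx, y, hy, e'⟩
    simpa [this] using hmem
  refine ⟨δ, hδ, fun a => ⟨fun ha => ?_, fun ha => hle ha⟩⟩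
  simpa [mul_assoc] using hle' ha

/-! ### From the colored conjecture to the general one. -/

variable {M} in
theorem ColoredIntersectionConjecture.isParabolic_of_isMinimal
    (hM : M.ColoredIntersectionConjecture) {X Y : Set I} {ω : M.ArtinGroup}
    (hX : M.toCoxeterSystem.IsMinimal X (M.artinToCoxeter ω))
    (hY : M.toCoxeterSystem.IsMinimal Y (M.artinToCoxeter ω)⁻¹) :
    M.IsParabolic (M.conjSubgroup ω⁻¹ (M.standardParabolic Y) ⊓ M.standardParabolic X) := by
  set d := M.artinToCoxeter ω with hd
  obtain ⟨h, hhX, hh, hconj⟩ := M.exists_conj_mem_of_isMinimal hX hY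
  obtain ⟨k, hkY, hk, kconj⟩ := M.exists_conj_mem_of_isMinimal (X := Y) (Y := X) (ω := ω⁻¹)
    (by rwa [map_inv]) (by rwa [map_inv, inv_inv])
  rw [map_inv, ← hd] at kconj
  rw [← hd] at hconj
  obtain ⟨δ, hδ, δconj⟩ := M.exists_lift_conj_mem_iff (Y := Y) hX
  set Z := M.conjInter X Y d
  have hc : h * ω⁻¹ * k⁻¹ * δ ∈ M.coloredArtinGroup := by
    rw [coloredArtinGroup, MonoidHom.mem_ker]
    simp [hh, hk, hδ, ← hd]
  convert (hM Z _ hc).conjSubgroup h⁻¹ using 1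
  ext a
  have e : δ * ((h * ω⁻¹ * k⁻¹ * δ)⁻¹ * (h * a * h⁻¹) * (h * ω⁻¹ * k⁻¹ * δ)) * δ⁻¹ =
      k * (ω * a * ω⁻¹) * k⁻¹ := by group
  simp only [Subgroup.mem_inf, mem_conjSubgroup, inv_inv]
  rw [← δconj, e]
  constructor
  · rintro ⟨h1, h2⟩
    exact ⟨kconj _ h1 (by simpa [mul_assoc] using h2), hconj a h2 h1⟩
  · rintro ⟨h1, h2⟩
    have h1 := M.standardParabolic_mono (fun y hy => hy.1) h1
    have h2 := M.standardParabolic_mono (fun x hx => hx.1) h2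
    rw [Subgroup.mul_mem_cancel_right _ (inv_mem hkY), Subgroup.mul_mem_cancel_left _ hkY] at h1
    rw [Subgroup.mul_mem_cancel_right _ (inv_mem hhX), Subgroup.mul_mem_cancel_left _ hhX] at h2
    exact ⟨h1, h2⟩

variable {M} in
theorem ColoredIntersectionConjecture.intersectionConjecture
    (hM : M.ColoredIntersectionConjecture) : M.IntersectionConjecture := by
  intro X Y ω
  -- The minimal case concerns `ω⁻¹ A_Y ω`, hence the inverse here. Lifting `u`, `v` to `a ∈ A_X`,
  -- `b ∈ A_Y` and replacing `ω⁻¹` by `b ω⁻¹ a` only conjugates the intersection by `a⁻¹`.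
  obtain ⟨u, hu, v, hv, hX, hY⟩ := M.toCoxeterSystem.exists_isMinimal_both X Y
    (M.artinToCoxeter ω⁻¹)
  obtain ⟨a, ha, rfl⟩ := M.exists_mem_standardParabolic hu
  obtain ⟨b, hb, rfl⟩ := M.exists_mem_standardParabolic hv
  rw [← map_mul, ← map_mul] at hX hY
  convert (hM.isParabolic_of_isMinimal hX hY).conjSubgroup a using 1
  ext c
  have e : b * ω⁻¹ * a * (a⁻¹ * c * a) * (b * ω⁻¹ * a)⁻¹ = b * (ω⁻¹ * c * ω) * b⁻¹ := by group
  simp only [Subgroup.mem_inf, mem_conjSubgroup, inv_inv]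
  rw [e, Subgroup.mul_mem_cancel_right _ (inv_mem hb), Subgroup.mul_mem_cancel_left _ hb,
    Subgroup.mul_mem_cancel_right _ ha, Subgroup.mul_mem_cancel_left _ (inv_mem ha)]

end CoxeterMatrix

theorem theorem1 {I : Type*} [Finite I] (M : CoxeterMatrix I) :
    M.ColoredIntersectionConjecture ↔ M.IntersectionConjecture :=
  ⟨fun h => h.intersectionConjecture, fun h X ω _ => h X X ω⟩
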